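/- Let $\lambda>0$ and $q\ge 0$. For each $m\ge 1$ let $(H_i,p_i)_{i=1}^m$ follow the two-groups model with null proportion $\pi_0=1$ and uniform null density: the pairs $(H_i,p_i)$ are i.i.d. with $H_i\sim\mathrm{Bern}(1-\pi_0)$, $p_i\mid H_i=0\sim\mathrm{Unif}(0,1)$, and $p_i\mid H_i=1$ having a density $f_1$ on $[0,1]$; as $\pi_0=1$, this says that almost surely $H_i=0$ for all $i$ (all hypotheses are null), and that $p_1,\dots,p_m$ are i.i.d. $\mathrm{Unif}(0,1)$. Let $p_{(1)}\le\dots\le p_{(m)}$ be the order statistics, $p_{(0)}=0$, let $R_q$ be the last minimizer of $k\mapsto p_{(k)}-qk/m$ over $k=0,\dots,m$, and let the support line procedure reject the hypotheses in $\mathcal R_q=\{i: p_i\le p_{(R_q)}\}$. For a rejection set $\mathcal R\subseteq\{1,\dots,m\}$ let $L_\lambda(H,\mathcal R)=\frac{(1+\lambda)V-R}{m}$, where $R=|\mathcal R|$ and $V=|\{i\in\mathcal R: H_i=0\}|$. Let $\mathcal R^*=\{i:\mathrm{lfdr}(p_i)\le \frac1{1+\lambda}\}$ be the oracle procedure, where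 $\mathrm{lfdr}(t)=\pi_0/(\pi_0+(1-\pi_0)f_1(t))$, and let $\mathrm{Regret}_m(\mathcal R)=\mathbb E\left[L_\lambda(H,\mathcal R)-L_\lambda(H,\mathcal R^*)\right]$. Then, as $m\to\infty$, $$m\,\mathrm{Regret}_m(\mathcal R_q)\;\to\;\lambda\sum_{k=1}^\infty \mathbb P\{U_k\le q\}\in[0,\infty],$$ where $U_k$ has the Gamma distribution with shape $k$ and rate $k$ (so mean $1$). The limit is finite for every $q\in[0,1)$. -/

import Mathlib

open MeasureTheory ProbabilityTheory Filter Topology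
open scoped ENNReal

namespace SupportLine

/-- `f` is a probability density on the real line that is supported on `[0, 1]`. -/
structure IsUnitDensity (f : ℝ → ℝ) : Prop where
  measurable : Measurable f
  nonneg : ∀ t, 0 ≤ f t
  eq_zero : ∀ t, t ∉ Set.Icc (0 : ℝ) 1 → f t = 0
  lintegral_eq_one : ∫⁻ t, ENNReal.ofReal (f t) = 1

/-- The joint law of one pair `(Hᵢ, pᵢ)` in the two-groups model with uniform null density:
`Hᵢ ∼ Bern(1 - π₀)`, `pᵢ ∣ Hᵢ = 0 ∼ Unif(0,1)`, and `pᵢ ∣ Hᵢ = 1` has density `f₁`.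
The value `0` of `Hᵢ` means that the `i`-th hypothesis is null. -/
noncomputable def twoGroupsLaw (pi0 : ℝ) (f1 : ℝ → ℝ) : Measure (Fin 2 × ℝ) :=
  ENNReal.ofReal pi0 •
      (Measure.dirac (0 : Fin 2)).prod ((volume : Measure ℝ).restrict (Set.Icc 0 1)) +
    ENNReal.ofReal (1 - pi0) •
      (Measure.dirac (1 : Fin 2)).prod
        ((volume : Measure ℝ).withDensity (fun t => ENNReal.ofReal (f1 t)))

/-- The random variables `H₁, …, Hₘ` and `p₁, …, pₘ` on the probability space `(Ω, μ)` follow the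
two-groups model with null proportion `π₀`, uniform null density and alternative density `f₁`:
the pairs `(Hᵢ, pᵢ)` are independent with the law `twoGroupsLaw`. -/
structure IsTwoGroups {Ω : Type*} [MeasurableSpace Ω] (μ : Measure Ω) (pi0 : ℝ) (f1 : ℝ → ℝ)
    {m : ℕ} (H : Fin m → Ω → Fin 2) (p : Fin m → Ω → ℝ) : Prop where
  pi0_mem : pi0 ∈ Set.Icc (0 : ℝ) 1
  density : IsUnitDensity f1
  measurable_H : ∀ i, Measurable (H i)
  measurable_p : ∀ i, Measurable (p i)
  law : ∀ i, μ.map (fun ω => (H i ω, p i ω)) = twoGroupsLaw pi0 f1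
  indep : iIndepFun (fun i ω => (H i ω, p i ω)) μ

/-- The local false discovery rate `π₀ / f(t)`, with `f = π₀ + (1 - π₀) f₁` on `[0, 1]`. -/
noncomputable def lfdr (pi0 : ℝ) (f1 : ℝ → ℝ) (t : ℝ) : ℝ :=
  pi0 / (pi0 + (1 - pi0) * f1 t)

/-- The order statistics `p₍₀₎ = 0` and `p₍₁₎ ≤ ⋯ ≤ p₍ₘ₎`. -/
noncomputable def orderStat {m : ℕ} (p : Fin m → ℝ) (k : Fin (m + 1)) : ℝ :=
  Fin.cases (motive := fun _ => ℝ) 0 (fun j => p (Tuple.sort p j)) k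

/-- The objective `p₍ₖ₎ - q k / m` of the support line procedure. -/
noncomputable def objective {m : ℕ} (q : ℝ) (p : Fin m → ℝ) (k : Fin (m + 1)) : ℝ :=
  orderStat p k - q * ((k : ℕ) : ℝ) / (m : ℝ)

/-- The set of minimizers of the objective over `k = 0, …, m`. -/
noncomputable def minimizers {m : ℕ} (q : ℝ) (p : Fin m → ℝ) : Finset (Fin (m + 1)) :=
  open scoped Classical in
  Finset.univ.filter (fun k => ∀ j, objective q p k ≤ objective q p j)

theorem minimizers_nonempty {m : ℕ} (q : ℝ) (p : Fin m → ℝ) : (minimizers q p).Nonempty := by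
  obtain ⟨k, hk⟩ := Finite.exists_min (objective q p)
  exact ⟨k, by simpa [minimizers] using hk⟩

/-- The last minimizer `R_q` of the objective. -/
noncomputable def lastMinimizer {m : ℕ} (q : ℝ) (p : Fin m → ℝ) : Fin (m + 1) :=
  (minimizers q p).max' (minimizers_nonempty q p)

/-- The support line procedure at level `q`: reject the hypotheses with `pᵢ ≤ τ_q`, where
`τ_q` is the order statistic with index `R_q`. -/
noncomputable def slProcedure {m : ℕ} (q : ℝ) (p : Fin m → ℝ) : Finset (Fin m) :=
  open scoped Classical in
  Finset.univ.filter (fun i => p i ≤ orderStat p (lastMinimizer q p))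

/-- The oracle procedure: reject the hypotheses with `lfdr(pᵢ) ≤ α`, where `α = 1 / (1 + λ)`. -/
noncomputable def oracleProcedure {m : ℕ} (lam pi0 : ℝ) (f1 : ℝ → ℝ) (p : Fin m → ℝ) :
    Finset (Fin m) :=
  open scoped Classical in
  Finset.univ.filter (fun i => lfdr pi0 f1 (p i) ≤ 1 / (1 + lam))

/-- The weighted classification loss `((1 + λ) V - R) / m` of a rejection set `S`, which makes
`R` rejections, of which `V` are rejections of null hypotheses. -/
noncomputable def loss {m : ℕ} (lam : ℝ) (H : Fin m → Fin 2) (S : Finset (Fin m)) : ℝ :=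
  ((1 + lam) * ((S.filter (fun i => H i = 0)).card : ℝ) - (S.card : ℝ)) / (m : ℝ)

/-- The excess loss of a multiple testing procedure `proc` over the oracle procedure. -/
noncomputable def excessLoss {m : ℕ} (lam pi0 : ℝ) (f1 : ℝ → ℝ)
    (proc : (Fin m → ℝ) → Finset (Fin m)) (H : Fin m → Fin 2) (p : Fin m → ℝ) : ℝ :=
  loss lam H (proc p) - loss lam H (oracleProcedure lam pi0 f1 p)

/-- The regret of a multiple testing procedure: its expected excess loss. -/
noncomputable def regret {Ω : Type*} [MeasurableSpace Ω] (μ : Measure Ω) {m : ℕ}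
    (lam pi0 : ℝ) (f1 : ℝ → ℝ) (H : Fin m → Ω → Fin 2) (p : Fin m → Ω → ℝ)
    (proc : (Fin m → ℝ) → Finset (Fin m)) : ℝ :=
  ∫ ω, excessLoss lam pi0 f1 proc (fun i => H i ω) (fun i => p i ω) ∂μ

/-- The sum over `k ≥ 1` of `P(U_k ≤ q)`, for `U_k` with the Gamma distribution of shape `k` and
rate `k`, as an extended nonnegative real. -/
noncomputable def gammaSum (q : ℝ) : ℝ≥0∞ :=
  ∑' k : ℕ, gammaMeasure ((k : ℝ) + 1) ((k : ℝ) + 1) (Set.Iic q)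

end SupportLine

/-! Under the global null every rejection is false, and the oracle rejects nothing because the lfdr
is identically `1 > 1 / (1 + λ)`. Hence `m` times the regret is `λ` times the mean of `R_q`
(`excessLoss_of_null`, `card_slProcedure`, `IsTwoGroups.mul_regret`), and only a uniform sample
remains to be studied.

The objective `p₍ₖ₎ - q k / m` is a walk whose steps are the spacings minus `q / m`. The joint
density of the steps is a function of their total times a product over the steps, so the steps are
exchangeable, and Sparre Andersen's identity (`lintegral_lastArgmin`) says that the last minimizer
has the same mean as the number of `k ≥ 1` with `p₍ₖ₎ ≤ q k / m`. That mean is a sum of the binomial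
tails `P(Bin(m, q k / m) ≥ k)` (`lintegral_lastMinimizer`, `unitCube_lt_card_filter`).

For fixed `k` the tail tends to `P(Poisson(q k) ≥ k) = P(U_k ≤ q)` (`tendsto_binomialTail`,
`gammaMeasure_Iic`). For `q < 1` a geometric Chernoff bound uniform in `m`
(`exists_binomialTail_le`) dominates the sum, which also gives finiteness. For `q ≥ 1` the limit sum
is infinite by comparison with the harmonic series (`gammaSum_eq_top`), and finite truncations force
divergence. -/

namespace SupportLine

/-! ### Partial sums and their last minimizer -/

/-- The sum of the first `k` coordinates of `x`. -/
noncomputable def partialSum {n : ℕ} (x : Fin n → ℝ) (k : ℕ) : ℝ :=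
  ∑ i : Fin n, if (i : ℕ) < k then x i else 0

lemma partialSum_zero {n : ℕ} (x : Fin n → ℝ) : partialSum x 0 = 0 := by
  simp [partialSum]

lemma partialSum_self {n : ℕ} (x : Fin n → ℝ) : partialSum x n = ∑ i, x i := by
  simp [partialSum]

lemma partialSum_succ {n : ℕ} (x : Fin n → ℝ) (k : Fin n) :
    partialSum x (k + 1) = partialSum x k + x k := by
  have h : ∀ i : Fin n, (if (i : ℕ) < (k : ℕ) + 1 then x i else 0) =
      (if (i : ℕ) < (k : ℕ) then x i else 0) + if i = k then x i else 0 := by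
    intro i
    rcases lt_trichotomy (i : ℕ) (k : ℕ) with h | h | h
    · have : i ≠ k := fun e => by simp [e] at h
      simp [h, this, h.trans (Nat.lt_succ_self _)]
    · obtain rfl := Fin.ext h
      simp
    · have : i ≠ k := fun e => by simp [e] at h
      simp [this, not_lt.2 h.le, not_lt.2 (Nat.succ_le_of_lt h)]
  simp_rw [partialSum, h, Finset.sum_add_distrib]
  simp

lemma partialSum_init {n : ℕ} (x : Fin (n + 1) → ℝ) {k : ℕ} (hk : k ≤ n) :
    partialSum (Fin.init x) k = partialSum x k := by
  simp [partialSum, Fin.sum_univ_castSucc, Fin.init, hk]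

lemma partialSum_tail {n : ℕ} (x : Fin (n + 1) → ℝ) (k : ℕ) :
    partialSum x (k + 1) = x 0 + partialSum (Fin.tail x) k := by
  simp [partialSum, Fin.sum_univ_succ, Fin.tail]

@[fun_prop]
lemma measurable_partialSum {n : ℕ} (k : ℕ) :
    Measurable (fun x : Fin n → ℝ => partialSum x k) := by
  unfold partialSum
  refine Finset.measurable_sum _ fun i _ => ?_
  split_ifs <;> fun_prop

/-- `k` is the last minimizer of the sequence `s` on `{0, …, n}`. -/
def IsLastArgmin (s : ℕ → ℝ) (n k : ℕ) : Prop :=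
  k ≤ n ∧ ∀ j ≤ n, s k ≤ s j ∧ (k < j → s k < s j)

lemma IsLastArgmin.eq {s : ℕ → ℝ} {n k l : ℕ} (hk : IsLastArgmin s n k)
    (hl : IsLastArgmin s n l) : k = l := by
  rcases lt_trichotomy k l with h | h | h
  · exact absurd ((hk.2 l hl.1).2 h) (not_lt.2 (hl.2 k hk.1).1)
  · exact h
  · exact absurd ((hl.2 k hk.1).2 h) (not_lt.2 (hk.2 l hl.1).1)

open scoped Classical in
/-- The last minimizer of the partial sums of `x`, by recursion on the length of `x`. -/
noncomputable def lastArgmin : {n : ℕ} → (Fin n → ℝ) → ℕ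
  | 0, _ => 0
  | _ + 1, x => if ∑ i, x i ≤ 0 then 1 + lastArgmin (Fin.tail x) else lastArgmin (Fin.init x)

/-- If the total is `≤ 0`, the final index does at least as well as index `0`, so the last minimizer
is not `0` and the first step can be dropped. If the total is positive, the final index loses to
index `0` and the last step can be dropped. -/
lemma isLastArgmin_lastArgmin {n : ℕ} (x : Fin n → ℝ) :
    IsLastArgmin (partialSum x) n (lastArgmin x) := by
  induction n with
  | zero =>
    refine ⟨le_rfl, fun j hj => ?_⟩
    obtain rfl := Nat.le_zero.1 hj
    simp [lastArgmin]
  | succ n ih =>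
    rw [lastArgmin]
    split_ifs with h
    · obtain ⟨h1, h2⟩ := ih (Fin.tail x)
      rw [add_comm 1]
      refine ⟨by omega, fun j hj => ?_⟩
      rw [partialSum_tail]
      cases j with
      | zero =>
        refine ⟨?_, fun h => absurd h (Nat.not_lt_zero _)⟩
        rw [partialSum_zero]
        have := (h2 n le_rfl).1
        rw [← partialSum_self, partialSum_tail] at h
        linarith
      | succ j =>
        rw [partialSum_tail]
        have := h2 j (by omega)
        exact ⟨by linarith [this.1], fun hlt => by linarith [this.2 (by omega)]⟩
    · obtain ⟨h1, h2⟩ := ih (Fin.init x)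
      rw [not_le, ← partialSum_self] at h
      refine ⟨by omega, fun j hj => ?_⟩
      rw [← partialSum_init x h1]
      rcases Nat.le_succ_iff.1 hj with hj | rfl
      · rw [← partialSum_init x hj]
        exact h2 j hj
      · have := (h2 0 (Nat.zero_le _)).1
        rw [partialSum_zero] at this
        exact ⟨by linarith, fun _ => by linarith⟩

open scoped Classical in
/-- The number of nonpositive partial sums of `x`, the empty one excluded. -/
noncomputable def nonposCount {n : ℕ} (x : Fin n → ℝ) : ℝ≥0∞ :=
  ∑ k ∈ Finset.range n, if partialSum x (k + 1) ≤ 0 then 1 else 0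

open scoped Classical in
lemma nonposCount_succ {n : ℕ} (x : Fin (n + 1) → ℝ) :
    nonposCount x = nonposCount (Fin.init x) + if ∑ i, x i ≤ 0 then 1 else 0 := by
  rw [nonposCount, Finset.sum_range_succ, partialSum_self, nonposCount]
  congr 1
  refine Finset.sum_congr rfl fun k hk => ?_
  rw [partialSum_init x (Finset.mem_range.1 hk)]

lemma measurable_init {n : ℕ} : Measurable (fun x : Fin (n + 1) → ℝ => Fin.init x) :=
  measurable_pi_lambda _ fun _ => measurable_pi_apply _

lemma measurable_tail {n : ℕ} : Measurable (fun x : Fin (n + 1) → ℝ => Fin.tail x) :=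
  measurable_pi_lambda _ fun _ => measurable_pi_apply _

lemma measurable_lastArgmin {n : ℕ} :
    Measurable (fun x : Fin n → ℝ => (lastArgmin x : ℝ≥0∞)) := by
  induction n with
  | zero => simp [lastArgmin]
  | succ n ih =>
    have h : (fun x : Fin (n + 1) → ℝ => (lastArgmin x : ℝ≥0∞)) = fun x =>
        open scoped Classical in
        if ∑ i, x i ≤ 0 then 1 + (lastArgmin (Fin.tail x) : ℝ≥0∞)
        else (lastArgmin (Fin.init x) : ℝ≥0∞) := by
      funext x
      rw [lastArgmin]
      split_ifs <;> simp
    rw [h]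
    refine Measurable.ite (measurableSet_le (by fun_prop) measurable_const) ?_ ?_
    · exact measurable_const.add (ih.comp measurable_tail)
    · exact ih.comp measurable_init

lemma measurable_nonposCount {n : ℕ} :
    Measurable (fun x : Fin n → ℝ => nonposCount x) := by
  unfold nonposCount
  refine Finset.measurable_sum _ fun k _ => ?_
  exact Measurable.ite (measurableSet_le (by fun_prop) measurable_const)
    measurable_const measurable_const

/-! ### Sparre Andersen's identity -/

/-- Integrating out the coordinate `i` against a density that is a function of the sum of the
coordinates times a product. -/
lemma lintegral_removeNth {n : ℕ} (i : Fin (n + 1)) {g h : ℝ → ℝ≥0∞} (hg : Measurable g)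
    (hh : Measurable h) {F : (Fin n → ℝ) → ℝ≥0∞} (hF : Measurable F) :
    ∫⁻ x : Fin (n + 1) → ℝ, g (∑ j, x j) * (∏ j, h (x j)) * F (i.removeNth x) =
      ∫⁻ y : Fin n → ℝ, (∫⁻ t, g (t + ∑ j, y j) * h t) * (∏ j, h (y j)) * F y := by
  have hmp := (volume_preserving_piFinSuccAbove (fun _ : Fin (n + 1) => ℝ) i).symm
  rw [← hmp.lintegral_comp_emb (MeasurableEquiv.measurableEmbedding _)]
  have hpt : ∀ z : ℝ × (Fin n → ℝ),
      g (∑ j, (MeasurableEquiv.piFinSuccAbove (fun _ => ℝ) i).symm z j) *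
        (∏ j, h ((MeasurableEquiv.piFinSuccAbove (fun _ => ℝ) i).symm z j)) *
        F (i.removeNth ((MeasurableEquiv.piFinSuccAbove (fun _ => ℝ) i).symm z)) =
      g (z.1 + ∑ j, z.2 j) * h z.1 * ((∏ j, h (z.2 j)) * F z.2) := by
    intro z
    have hz : (MeasurableEquiv.piFinSuccAbove (fun _ => ℝ) i).symm z =
      i.insertNth (α := fun _ => ℝ) z.1 z.2 := rfl
    rw [hz, Fin.removeNth_insertNth, Fin.sum_univ_succAbove _ i, Fin.prod_univ_succAbove _ i]
    simp only [Fin.insertNth_apply_same, Fin.insertNth_apply_succAbove]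
    ring
  simp_rw [hpt]
  rw [Measure.volume_eq_prod, lintegral_prod_symm' _ (by fun_prop)]
  refine lintegral_congr fun y => ?_
  rw [mul_assoc, ← lintegral_mul_const _ (by fun_prop)]

/-- **Sparre Andersen's theorem** in expectation: if the density of `x` is a function of the sum of
the coordinates times a product, then the index of the last minimum of the partial sums has the
same mean as the number of nonpositive partial sums. -/
theorem lintegral_lastArgmin {n : ℕ} {g h : ℝ → ℝ≥0∞} (hg : Measurable g) (hh : Measurable h) :
    ∫⁻ x : Fin n → ℝ, g (∑ j, x j) * (∏ j, h (x j)) * (lastArgmin x : ℝ≥0∞) =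
      ∫⁻ x : Fin n → ℝ, g (∑ j, x j) * (∏ j, h (x j)) * nonposCount x := by
  classical
  induction n generalizing g with
  | zero => simp [lastArgmin, nonposCount]
  | succ n ih =>
    -- Splitting by the sign of the total only alters the factor `g`, so both pieces keep the form
    -- of the density.
    set a : ℝ → ℝ≥0∞ := fun s => if s ≤ 0 then g s else 0 with ha_def
    set b : ℝ → ℝ≥0∞ := fun s => if s ≤ 0 then 0 else g s with hb_def
    have ha : Measurable a := Measurable.ite measurableSet_Iic hg measurable_const
    have hb : Measurable b := Measurable.ite measurableSet_Iic measurable_const hg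
    have key : ∀ (u : ℝ → ℝ≥0∞) (i j : Fin (n + 1)), Measurable u →
        ∫⁻ x : Fin (n + 1) → ℝ,
            u (∑ j, x j) * (∏ j, h (x j)) * (lastArgmin (i.removeNth x) : ℝ≥0∞) =
          ∫⁻ x : Fin (n + 1) → ℝ,
            u (∑ j, x j) * (∏ j, h (x j)) * nonposCount (j.removeNth x) := by
      intro u i j hu
      rw [lintegral_removeNth i hu hh measurable_lastArgmin,
        lintegral_removeNth j hu hh measurable_nonposCount]
      -- Integrating out one coordinate again leaves a function of the sum times a product, the same
      -- one whichever coordinate goes. This is why the induction is over all `g`, and why dropping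
      -- the first step may be traded for dropping the last.
      refine ih (g := fun s => ∫⁻ t, u (t + s) * h t) ?_
      exact Measurable.lintegral_prod_left' (f := fun z : ℝ × ℝ => u (z.1 + z.2) * h z.1)
        (by fun_prop)
    have hL : ∀ x : Fin (n + 1) → ℝ,
        g (∑ j, x j) * (∏ j, h (x j)) * (lastArgmin x : ℝ≥0∞) =
          a (∑ j, x j) * (∏ j, h (x j)) +
          (a (∑ j, x j) * (∏ j, h (x j)) *
              (lastArgmin ((0 : Fin (n + 1)).removeNth x) : ℝ≥0∞) +
            b (∑ j, x j) * (∏ j, h (x j)) *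
              (lastArgmin ((Fin.last n).removeNth x) : ℝ≥0∞)) := by
      intro x
      rw [Fin.removeNth_zero, Fin.removeNth_last, lastArgmin]
      by_cases hx : ∑ i, x i ≤ 0
      · simp [a, b, hx, mul_add]
      · simp [a, b, hx]
    have hN : ∀ x : Fin (n + 1) → ℝ,
        g (∑ j, x j) * (∏ j, h (x j)) * nonposCount x =
          a (∑ j, x j) * (∏ j, h (x j)) +
          (a (∑ j, x j) * (∏ j, h (x j)) * nonposCount ((Fin.last n).removeNth x) +
            b (∑ j, x j) * (∏ j, h (x j)) * nonposCount ((Fin.last n).removeNth x)) := by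
      intro x
      rw [Fin.removeNth_last, nonposCount_succ]
      by_cases hx : ∑ i, x i ≤ 0
      · simp [a, b, hx, mul_add, add_comm]
      · simp [a, b, hx]
    have hrm : ∀ i : Fin (n + 1), Measurable (fun x : Fin (n + 1) → ℝ => i.removeNth x) :=
      fun i => measurable_pi_lambda _ fun _ => measurable_pi_apply _
    have hl := fun i => measurable_lastArgmin.comp (hrm i)
    have hn := fun i => measurable_nonposCount.comp (hrm i)
    simp only [Function.comp_def] at hl hn
    simp_rw [hL, hN]
    have hw : Measurable (fun x : Fin (n + 1) → ℝ => a (∑ j, x j) * ∏ j, h (x j)) := by fun_prop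
    have hwl : Measurable (fun x : Fin (n + 1) → ℝ => a (∑ j, x j) * (∏ j, h (x j)) *
        (lastArgmin ((0 : Fin (n + 1)).removeNth x) : ℝ≥0∞)) := hw.mul (hl 0)
    have hwn : Measurable (fun x : Fin (n + 1) → ℝ => a (∑ j, x j) * (∏ j, h (x j)) *
        nonposCount ((Fin.last n).removeNth x)) := hw.mul (hn _)
    rw [lintegral_add_left hw, lintegral_add_left hw, lintegral_add_left hwl,
      lintegral_add_left hwn,
      key a 0 (Fin.last n) ha, key b (Fin.last n) (Fin.last n) hb]

/-! ### Order statistics and spacings of a uniform sample -/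

/-- The uniform distribution on the unit cube. -/
noncomputable def unitCube (m : ℕ) : Measure (Fin m → ℝ) :=
  Measure.pi fun _ => (volume : Measure ℝ).restrict (Set.Icc 0 1)

lemma unitCube_eq_restrict (m : ℕ) :
    unitCube m = volume.restrict (Set.univ.pi fun _ : Fin m => Set.Ioc (0 : ℝ) 1) := by
  rw [unitCube, volume_pi, Measure.restrict_pi_pi]
  simp_rw [Measure.restrict_congr_set (Ioc_ae_eq_Icc (μ := (volume : Measure ℝ)) (a := 0) (b := 1))]

instance (m : ℕ) : IsProbabilityMeasure (unitCube m) := by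
  have : IsProbabilityMeasure ((volume : Measure ℝ).restrict (Set.Icc 0 1)) := ⟨by simp⟩
  unfold unitCube
  infer_instance

/-- Ties lie in finitely many proper subspaces, which are Lebesgue-null. -/
lemma ae_injective (m : ℕ) : ∀ᵐ p ∂unitCube m, Function.Injective p := by
  rw [unitCube_eq_restrict]
  refine ae_restrict_of_ae ?_
  have h : ∀ i j : Fin m, i ≠ j → ∀ᵐ p : Fin m → ℝ, p i ≠ p j := by
    intro i j hij
    let f : (Fin m → ℝ) →ₗ[ℝ] ℝ := LinearMap.proj i - (LinearMap.proj j : (Fin m → ℝ) →ₗ[ℝ] ℝ)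
    have hf : LinearMap.ker f ≠ ⊤ := by
      intro h
      have : (Pi.single i 1 : Fin m → ℝ) ∈ LinearMap.ker f := h ▸ Submodule.mem_top
      simp [f, hij.symm] at this
    have := Measure.addHaar_submodule (volume : Measure (Fin m → ℝ)) _ hf
    rw [ae_iff]
    convert this using 2
    ext p
    simp [f, sub_eq_zero]
  have h' : ∀ᵐ p : Fin m → ℝ, ∀ i j, i ≠ j → p i ≠ p j := by
    rw [ae_all_iff]; intro i
    rw [ae_all_iff]; intro j
    by_cases hij : i = j
    · simp [hij]
    · filter_upwards [h i j hij] with p hp _ using hp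
  filter_upwards [h'] with p hp i j hpij
  by_contra hij
  exact hp i j hij hpij

lemma ae_mem_Ioc (m : ℕ) : ∀ᵐ p ∂unitCube m, ∀ i, p i ∈ Set.Ioc (0 : ℝ) 1 := by
  rw [unitCube_eq_restrict]
  filter_upwards [ae_restrict_mem (MeasurableSet.univ_pi fun _ => measurableSet_Ioc)] with p hp i
    using hp i trivial

lemma measurePreserving_comp_perm {m : ℕ} (σ : Equiv.Perm (Fin m)) :
    MeasurePreserving (fun p : Fin m → ℝ => p ∘ σ) (unitCube m) (unitCube m) := by
  have h := measurePreserving_piCongrLeft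
    (fun _ : Fin m => (volume : Measure ℝ).restrict (Set.Icc 0 1)) σ.symm
  have hfun : ⇑(MeasurableEquiv.piCongrLeft (fun _ : Fin m => ℝ) σ.symm) = fun p => p ∘ σ := by
    funext p k
    obtain ⟨i, rfl⟩ := σ.symm.surjective k
    rw [MeasurableEquiv.piCongrLeft_apply_apply]
    simp
  rw [hfun] at h
  exact h

lemma measurableSet_strictMono (m : ℕ) : MeasurableSet {y : Fin m → ℝ | StrictMono y} := by
  have : {y : Fin m → ℝ | StrictMono y} = ⋂ i, ⋂ j, {y | i < j → y i < y j} := by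
    ext y
    simp [StrictMono]
  rw [this]
  refine MeasurableSet.iInter fun i => MeasurableSet.iInter fun j => ?_
  by_cases h : i < j
  · simpa [h] using measurableSet_lt (measurable_pi_apply i) (measurable_pi_apply j)
  · simp [h]

/-- Exactly one permutation arranges distinct values increasingly; the other terms vanish. -/
lemma sum_strictMono_comp {m : ℕ} {p : Fin m → ℝ} (hp : Function.Injective p)
    (G : (Fin m → ℝ) → ℝ≥0∞) :
    ∑ σ : Equiv.Perm (Fin m), {y : Fin m → ℝ | StrictMono y}.indicator G (p ∘ σ) =
      G (p ∘ Tuple.sort p) := by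
  rw [Finset.sum_eq_single (Tuple.sort p)]
  · rw [Set.indicator_of_mem]
    exact (Tuple.monotone_sort p).strictMono_of_injective (hp.comp (Equiv.injective _))
  · intro σ _ hσ
    refine Set.indicator_of_notMem (fun h => hσ ?_) _
    have h : StrictMono (p ∘ σ) := h
    rw [Tuple.eq_sort_iff]
    exact ⟨h.monotone, fun i j hij he => absurd he (h hij).ne⟩
  · simp

/-- The law of the order statistics of a uniform sample. -/
lemma lintegral_comp_sort {m : ℕ} {G : (Fin m → ℝ) → ℝ≥0∞} (hG : Measurable G) :
    ∫⁻ p, G (p ∘ Tuple.sort p) ∂unitCube m =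
      m.factorial * ∫⁻ y, {y : Fin m → ℝ | StrictMono y}.indicator G y ∂unitCube m := by
  have hG' := hG.indicator (measurableSet_strictMono m)
  calc ∫⁻ p, G (p ∘ Tuple.sort p) ∂unitCube m
      = ∫⁻ p, ∑ σ : Equiv.Perm (Fin m),
          {y : Fin m → ℝ | StrictMono y}.indicator G (p ∘ σ) ∂unitCube m := by
        refine lintegral_congr_ae ?_
        filter_upwards [ae_injective m] with p hp using (sum_strictMono_comp hp G).symm
    _ = ∑ σ : Equiv.Perm (Fin m),
          ∫⁻ y, {y : Fin m → ℝ | StrictMono y}.indicator G y ∂unitCube m := by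
        rw [lintegral_finsetSum]
        · exact Finset.sum_congr rfl fun σ _ =>
            (measurePreserving_comp_perm σ).lintegral_comp hG'
        · exact fun σ _ => hG'.comp (measurePreserving_comp_perm σ).measurable
    _ = _ := by simp [Fintype.card_perm]

/-- The sequence whose increments exceed those of the partial sums of `x` by `c`. -/
noncomputable def shiftedSum {m : ℕ} (c : ℝ) (x : Fin m → ℝ) (k : Fin m) : ℝ :=
  partialSum x (k + 1) + c * ((k : ℕ) + 1)

/-- Up to a translation the map is linear with a lower unitriangular matrix, so its Jacobian is `1`.
-/
lemma measurePreserving_shiftedSum {m : ℕ} (c : ℝ) :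
    MeasurePreserving (shiftedSum (m := m) c) volume volume := by
  let M : Matrix (Fin m) (Fin m) ℝ := Matrix.of fun k i => if i ≤ k then 1 else 0
  have hdet : M.det = 1 := by
    rw [Matrix.det_of_isLowerTriangular]
    · simp [M]
    · intro i j hij
      simpa [M] using hij
  have h1 : MeasurePreserving (Matrix.toLin' M) volume volume := by
    refine ⟨(Matrix.toLin' M).continuous_on_pi.measurable, ?_⟩
    rw [Real.map_matrix_volume_pi_eq_smul_volume_pi (by simp [hdet]), hdet]
    simp
  have h2 := measurePreserving_add_right (volume : Measure (Fin m → ℝ))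
    (fun k : Fin m => c * (((k : ℕ) : ℝ) + 1))
  have h3 : shiftedSum (m := m) c =
      (fun x => x + fun k : Fin m => c * (((k : ℕ) : ℝ) + 1)) ∘ Matrix.toLin' M := by
    ext x k
    simp [shiftedSum, partialSum, M, Matrix.mulVec, dotProduct]
  rw [h3]
  exact h2.comp h1

/-- The support of the ordered sample becomes one condition on the total and one on each coordinate,
as `lintegral_lastArgmin` requires. Excluding the endpoint `0` makes the first spacing strictly
positive, like the others. -/
lemma shiftedSum_strictMono_iff {m : ℕ} (c : ℝ) (x : Fin m → ℝ) :
    (StrictMono (shiftedSum c x) ∧ ∀ i, shiftedSum c x i ∈ Set.Ioc (0 : ℝ) 1) ↔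
      (∑ i, x i + c * m ≤ 1) ∧ ∀ i, 0 < x i + c := by
  let s : ℕ → ℝ := fun k => partialSum x k + c * k
  have hs : ∀ k : Fin m, s (k + 1) = shiftedSum c x k := fun k => by simp [s, shiftedSum]
  have hs0 : s 0 = 0 := by simp [s, partialSum_zero]
  have hsm : s m = ∑ i, x i + c * m := by simp [s, partialSum_self]
  have hd : ∀ k : Fin m, s (k + 1) = s k + (x k + c) := by
    intro k
    simp only [s, partialSum_succ]
    push_cast
    ring
  rw [← hsm]
  constructor
  · rintro ⟨hmono, hmem⟩
    constructor
    · cases m with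
      | zero => simp [hs0]
      | succ m => exact (hs (Fin.last m)) ▸ (hmem (Fin.last m)).2
    · rintro ⟨i, hi⟩
      have h1 := hd ⟨i, hi⟩
      cases i with
      | zero =>
        have h2 := (hmem ⟨0, hi⟩).1
        rw [← hs] at h2
        simp only [hs0] at h1 h2
        linarith
      | succ i =>
        have h2 := hmono (show (⟨i, by omega⟩ : Fin m) < ⟨i + 1, hi⟩ from Nat.lt_succ_self i)
        rw [← hs, ← hs] at h2
        simp only at h1 h2
        linarith
  · rintro ⟨hm, hpos⟩
    have hlt : ∀ a b : ℕ, a < b → b ≤ m → s a < s b := by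
      intro a b hab
      induction b, hab using Nat.le_induction with
      | base => exact fun h => by linarith [hd ⟨a, h⟩, hpos ⟨a, h⟩]
      | succ b hb ih => exact fun h => by linarith [ih (by omega), hd ⟨b, h⟩, hpos ⟨b, h⟩]
    refine ⟨fun i j hij => ?_, fun i => ⟨?_, ?_⟩⟩
    · rw [← hs, ← hs]
      exact hlt _ _ (Nat.succ_lt_succ hij) j.2
    · rw [← hs, ← hs0]
      exact hlt _ _ (Nat.succ_pos _) i.2
    · rw [← hs]
      rcases Nat.eq_or_lt_of_le (show (i : ℕ) + 1 ≤ m from i.2) with h | h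
      · rw [h]; exact hm
      · exact ((hlt _ _ h le_rfl).trans_le hm).le

open scoped Classical in
/-- The order statistics of a uniform sample in terms of their increments. -/
lemma lintegral_comp_sort_eq_shiftedSum {m : ℕ} (c : ℝ) {G : (Fin m → ℝ) → ℝ≥0∞}
    (hG : Measurable G) :
    ∫⁻ p, G (p ∘ Tuple.sort p) ∂unitCube m =
      m.factorial * ∫⁻ x : Fin m → ℝ, (if ∑ i, x i + c * m ≤ 1 then 1 else 0) *
        (∏ i, if 0 < x i + c then 1 else 0) *
        {y : Fin m → ℝ | StrictMono y}.indicator G (shiftedSum c x) := by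
  have hG' := hG.indicator (measurableSet_strictMono m)
  have hcube : MeasurableSet (Set.univ.pi fun _ : Fin m => Set.Ioc (0 : ℝ) 1) :=
    MeasurableSet.univ_pi fun _ => measurableSet_Ioc
  rw [lintegral_comp_sort hG, unitCube_eq_restrict, ← lintegral_indicator hcube,
    ← (measurePreserving_shiftedSum c).lintegral_comp (hG'.indicator hcube)]
  congr 1
  refine lintegral_congr fun x => ?_
  have h := shiftedSum_strictMono_iff c x
  by_cases hx : (∑ i, x i + c * m ≤ 1) ∧ ∀ i, 0 < x i + c
  · obtain ⟨h1, h2⟩ := h.2 hx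
    rw [Set.indicator_of_mem (by simpa using h2)]
    simp [hx.1, hx.2]
  · have hz : (if ∑ i, x i + c * m ≤ 1 then (1 : ℝ≥0∞) else 0) *
        (∏ i, if 0 < x i + c then 1 else 0) = 0 := by
      rw [not_and_or, not_forall] at hx
      rcases hx with hx | ⟨i, hi⟩
      · simp [hx]
      · rw [Finset.prod_eq_zero (Finset.mem_univ i) (by simp [hi]), mul_zero]
    rw [hz, zero_mul, Set.indicator_apply]
    split_ifs with h1
    · exact Set.indicator_of_notMem (fun h2 => hx (h.1 ⟨h2, by simpa using h1⟩)) _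
    · rfl

/-! ### The last minimizer of the procedure as that of a walk -/

/-- `Tuple.sort` takes finitely many values, each on a set cut out by finitely many comparisons of
coordinates. -/
lemma measurable_orderStat {m : ℕ} (k : Fin (m + 1)) :
    Measurable (fun p : Fin m → ℝ => orderStat p k) := by
  cases k using Fin.cases with
  | zero => simp [orderStat]
  | succ j =>
    simp only [orderStat, Fin.cases_succ]
    have hs : ∀ σ : Equiv.Perm (Fin m), MeasurableSet {p : Fin m → ℝ | Tuple.sort p = σ} := by
      intro σ
      simp_rw [eq_comm (b := σ), Tuple.eq_sort_iff]
      refine MeasurableSet.inter ?_ ?_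
      · have : {p : Fin m → ℝ | Monotone (p ∘ σ)} =
            ⋂ i, ⋂ j, {p : Fin m → ℝ | i ≤ j → p (σ i) ≤ p (σ j)} := by
          ext p
          simp [Monotone]
        change MeasurableSet {p : Fin m → ℝ | Monotone (p ∘ σ)}
        rw [this]
        refine MeasurableSet.iInter fun i => MeasurableSet.iInter fun j => ?_
        by_cases h : i ≤ j
        · simpa [h] using measurableSet_le (measurable_pi_apply (σ i)) (measurable_pi_apply (σ j))
        · simp [h]
      · have : {p : Fin m → ℝ | ∀ i j, i < j → p (σ i) = p (σ j) → σ i < σ j} =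
            ⋂ i, ⋂ j, {p : Fin m → ℝ | i < j → p (σ i) = p (σ j) → σ i < σ j} := by
          ext p
          simp
        change MeasurableSet {p : Fin m → ℝ | ∀ i j, i < j → p (σ i) = p (σ j) → σ i < σ j}
        rw [this]
        refine MeasurableSet.iInter fun i => MeasurableSet.iInter fun j => ?_
        -- The constraint on `p` is vacuous except in this case, where it says that the two
        -- coordinates differ.
        by_cases h : i < j ∧ ¬ σ i < σ j
        · have := (measurableSet_eq_fun (measurable_pi_apply (σ i) :
            Measurable (fun p : Fin m → ℝ => p (σ i))) (measurable_pi_apply (σ j))).compl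
          convert this using 1
          ext p
          simp only [Set.mem_ofPred_eq, Set.mem_compl_iff]
          tauto
        · convert MeasurableSet.univ using 1
          ext p
          simp only [Set.mem_ofPred_eq, Set.mem_univ, iff_true]
          tauto
    intro t ht
    have : (fun p : Fin m → ℝ => p (Tuple.sort p j)) ⁻¹' t =
        ⋃ σ : Equiv.Perm (Fin m), {p | Tuple.sort p = σ} ∩ {p | p (σ j) ∈ t} := by
      ext p
      simp
    rw [this]
    exact MeasurableSet.iUnion fun σ => (hs σ).inter (measurable_pi_apply (σ j) ht)

lemma measurable_objective {m : ℕ} (q : ℝ) (k : Fin (m + 1)) :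
    Measurable (fun p : Fin m → ℝ => objective q p k) :=
  (measurable_orderStat k).sub measurable_const

lemma lastMinimizer_spec {m : ℕ} (q : ℝ) (p : Fin m → ℝ) (j : Fin (m + 1)) :
    objective q p (lastMinimizer q p) ≤ objective q p j ∧
      (lastMinimizer q p < j → objective q p (lastMinimizer q p) < objective q p j) := by
  have h := (minimizers q p).max'_mem (minimizers_nonempty q p)
  change lastMinimizer q p ∈ _ at h
  simp only [minimizers, Finset.mem_filter, Finset.mem_univ, true_and] at h
  refine ⟨h j, fun hlt => lt_of_not_ge fun hle => ?_⟩
  have hj : j ∈ minimizers q p := by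
    simp only [minimizers, Finset.mem_filter, Finset.mem_univ, true_and]
    exact fun l => hle.trans (h l)
  exact absurd ((minimizers q p).le_max' j hj) (not_le.2 hlt)

lemma lastMinimizer_eq_iff {m : ℕ} (q : ℝ) (p : Fin m → ℝ) (k : Fin (m + 1)) :
    lastMinimizer q p = k ↔
      ∀ j, objective q p k ≤ objective q p j ∧ (k < j → objective q p k < objective q p j) := by
  constructor
  · rintro rfl
    exact lastMinimizer_spec q p
  · intro h
    have h' := lastMinimizer_spec q p
    rcases lt_trichotomy (lastMinimizer q p) k with hlt | heq | hlt
    · exact absurd ((h' k).2 hlt) (not_lt.2 (h _).1)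
    · exact heq
    · exact absurd ((h _).2 hlt) (not_lt.2 (h' k).1)

lemma measurable_lastMinimizer {m : ℕ} (q : ℝ) :
    Measurable (fun p : Fin m → ℝ => lastMinimizer q p) := by
  refine measurable_to_countable' fun k => ?_
  have : (fun p : Fin m → ℝ => lastMinimizer q p) ⁻¹' {k} =
      ⋂ j, ({p | objective q p k ≤ objective q p j} ∩
        {p | k < j → objective q p k < objective q p j}) := by
    ext p
    simp [lastMinimizer_eq_iff]
  rw [this]
  refine MeasurableSet.iInter fun j => MeasurableSet.inter ?_ ?_
  · exact measurableSet_le (measurable_objective q k) (measurable_objective q j)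
  · by_cases h : k < j
    · simpa [h] using measurableSet_lt (measurable_objective q k) (measurable_objective q j)
    · simp [h]

lemma lastMinimizer_comp_sort {m : ℕ} (q : ℝ) (p : Fin m → ℝ) :
    lastMinimizer q (p ∘ Tuple.sort p) = lastMinimizer q p := by
  have h : orderStat (p ∘ Tuple.sort p) = orderStat p := by
    funext k
    cases k using Fin.cases with
    | zero => simp [orderStat]
    | succ j =>
      exact congrFun (Tuple.comp_perm_comp_sort_eq_comp_sort (f := p) (σ := Tuple.sort p)) j
  have h' : objective q (p ∘ Tuple.sort p) = objective q p := by
    funext k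
    simp [objective, h]
  rw [lastMinimizer_eq_iff, h']
  exact lastMinimizer_spec q p

/-- The drift `q / m` cancels the linear term of the objective and leaves the bare walk. -/
lemma objective_shiftedSum {m : ℕ} (q : ℝ) {x : Fin m → ℝ}
    (hx : StrictMono (shiftedSum (q / m) x)) (k : Fin (m + 1)) :
    objective q (shiftedSum (q / m) x) k = partialSum x k := by
  have hsort := Tuple.sort_eq_refl_iff_monotone.2 hx.monotone
  cases k using Fin.cases with
  | zero => simp [objective, orderStat, partialSum_zero]
  | succ j =>
    simp only [objective, orderStat, Fin.cases_succ, hsort, Equiv.refl_apply, shiftedSum,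
      Fin.val_succ]
    push_cast
    ring

lemma lastMinimizer_shiftedSum {m : ℕ} (q : ℝ) {x : Fin m → ℝ}
    (hx : StrictMono (shiftedSum (q / m) x)) :
    (lastMinimizer q (shiftedSum (q / m) x) : ℕ) = lastArgmin x := by
  refine IsLastArgmin.eq ⟨Nat.lt_succ_iff.1 (Fin.is_lt _), fun j hj => ?_⟩
    (isLastArgmin_lastArgmin x)
  have h := lastMinimizer_spec q (shiftedSum (q / m) x) ⟨j, Nat.lt_succ_of_le hj⟩
  rw [objective_shiftedSum q hx, objective_shiftedSum q hx] at h
  exact h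

open scoped Classical in
/-- The mean number of rejections under the uniform distribution. -/
theorem lintegral_lastMinimizer (m : ℕ) (q : ℝ) :
    ∫⁻ p, ((lastMinimizer q p : ℕ) : ℝ≥0∞) ∂unitCube m =
      ∑ k ∈ Finset.range m, unitCube m
        {p | k < (Finset.univ.filter fun i => p i ≤ q * ((k : ℝ) + 1) / m).card} := by
  let G : (Fin m → ℝ) → ℝ≥0∞ := fun y => ((lastMinimizer q y : ℕ) : ℝ≥0∞)
  let G' : (Fin m → ℝ) → ℝ≥0∞ := fun y =>
    ∑ k : Fin m, if y k ≤ q * (((k : ℕ) : ℝ) + 1) / m then 1 else 0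
  have hG : Measurable G :=
    (Measurable.of_discrete (f := fun k : Fin (m + 1) => ((k : ℕ) : ℝ≥0∞))).comp
      (measurable_lastMinimizer q)
  have hind : ∀ k : Fin m, Measurable (fun y : Fin m → ℝ =>
      if y k ≤ q * (((k : ℕ) : ℝ) + 1) / m then (1 : ℝ≥0∞) else 0) := fun k =>
    Measurable.ite (measurableSet_le (measurable_pi_apply k) measurable_const)
      measurable_const measurable_const
  have hG' : Measurable G' := Finset.measurable_sum _ fun k _ => hind k
  have h1 : ∫⁻ p, ((lastMinimizer q p : ℕ) : ℝ≥0∞) ∂unitCube m =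
      ∫⁻ p, G (p ∘ Tuple.sort p) ∂unitCube m :=
    lintegral_congr fun p => by simp only [G, lastMinimizer_comp_sort]
  have h2 : ∫⁻ p, G (p ∘ Tuple.sort p) ∂unitCube m =
      ∫⁻ p, G' (p ∘ Tuple.sort p) ∂unitCube m := by
    rw [lintegral_comp_sort_eq_shiftedSum (q / m) hG,
      lintegral_comp_sort_eq_shiftedSum (q / m) hG']
    congr 1
    -- Where the density is nonzero the sequence is increasing, so the procedure can be read off
    -- from the walk; elsewhere both integrands vanish.
    have hmem : ∀ x : Fin m → ℝ, (if ∑ i, x i + q / m * m ≤ 1 then (1 : ℝ≥0∞) else 0) *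
        (∏ i, if 0 < x i + q / m then 1 else 0) ≠ 0 → StrictMono (shiftedSum (q / m) x) := by
      intro x hx
      refine ((shiftedSum_strictMono_iff (q / m) x).2 ⟨?_, ?_⟩).1
      · by_contra h
        simp [h] at hx
      · intro i
        by_contra h
        exact hx (by rw [Finset.prod_eq_zero (Finset.mem_univ i) (by simp [h]), mul_zero])
    have hA : ∀ x : Fin m → ℝ, (if ∑ i, x i + q / m * m ≤ 1 then (1 : ℝ≥0∞) else 0) *
        (∏ i, if 0 < x i + q / m then 1 else 0) *
          {y : Fin m → ℝ | StrictMono y}.indicator G (shiftedSum (q / m) x) =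
        (if ∑ i, x i + q / m * m ≤ 1 then (1 : ℝ≥0∞) else 0) *
        (∏ i, if 0 < x i + q / m then 1 else 0) * (lastArgmin x : ℝ≥0∞) := by
      intro x
      by_cases hx : (if ∑ i, x i + q / m * m ≤ 1 then (1 : ℝ≥0∞) else 0) *
        (∏ i, if 0 < x i + q / m then 1 else 0) = 0
      · rw [hx, zero_mul, zero_mul]
      · rw [Set.indicator_of_mem (hmem x hx)]
        simp only [G, lastMinimizer_shiftedSum q (hmem x hx)]
    have hB : ∀ x : Fin m → ℝ, (if ∑ i, x i + q / m * m ≤ 1 then (1 : ℝ≥0∞) else 0) *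
        (∏ i, if 0 < x i + q / m then 1 else 0) *
          {y : Fin m → ℝ | StrictMono y}.indicator G' (shiftedSum (q / m) x) =
        (if ∑ i, x i + q / m * m ≤ 1 then (1 : ℝ≥0∞) else 0) *
        (∏ i, if 0 < x i + q / m then 1 else 0) * nonposCount x := by
      intro x
      by_cases hx : (if ∑ i, x i + q / m * m ≤ 1 then (1 : ℝ≥0∞) else 0) *
        (∏ i, if 0 < x i + q / m then 1 else 0) = 0
      · rw [hx, zero_mul, zero_mul]
      · rw [Set.indicator_of_mem (hmem x hx)]
        congr 1
        simp only [G', nonposCount, Finset.sum_range]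
        refine Finset.sum_congr rfl fun k _ => ?_
        have : shiftedSum (q / m) x k ≤ q * (((k : ℕ) : ℝ) + 1) / m ↔
            partialSum x (k + 1) ≤ 0 := by
          rw [shiftedSum, div_mul_eq_mul_div]
          constructor <;> intro h <;> linarith
        simp only [this]
    simp_rw [hA, hB]
    -- Here `g` keeps the largest order statistic below `1` and `h` keeps each spacing positive.
    exact lintegral_lastArgmin
      (g := fun s => if s + q / m * m ≤ 1 then (1 : ℝ≥0∞) else 0)
      (h := fun t => if 0 < t + q / m then (1 : ℝ≥0∞) else 0)
      (Measurable.ite (measurableSet_le (by fun_prop) measurable_const)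
        measurable_const measurable_const)
      (Measurable.ite (measurableSet_lt measurable_const (by fun_prop))
        measurable_const measurable_const)
  -- Indices start at `0`: the entry `k` of the sorted sample is `p₍ₖ₊₁₎`, hence "more than `k`"
  -- points.
  have hcount : ∀ (p : Fin m → ℝ) (k : Fin m) (a : ℝ),
      (p ∘ Tuple.sort p) k ≤ a ↔ (k : ℕ) < (Finset.univ.filter fun i => p i ≤ a).card := by
    intro p k a
    rw [← Tuple.lt_card_le_iff_apply_le_of_monotone (Tuple.monotone_sort p)]
    have : (Finset.univ.filter fun i => (p ∘ Tuple.sort p) i ≤ a).card =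
        (Finset.univ.filter fun i => p i ≤ a).card := by
      refine Finset.card_equiv (Tuple.sort p) fun i => ?_
      simp
    convert Iff.rfl using 2
    convert this.symm
  have hcard : ∀ a : ℝ, Measurable (fun p : Fin m → ℝ =>
      (Finset.univ.filter fun i => p i ≤ a).card) := by
    intro a
    simp_rw [Finset.card_filter]
    refine Finset.measurable_sum _ fun i _ => ?_
    exact Measurable.ite (measurableSet_le (measurable_pi_apply i) measurable_const)
      measurable_const measurable_const
  have hset : ∀ k : ℕ, MeasurableSet {p : Fin m → ℝ |
      k < (Finset.univ.filter fun i => p i ≤ q * ((k : ℝ) + 1) / m).card} := fun k =>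
    measurableSet_lt measurable_const (hcard _)
  rw [h1, h2]
  simp only [G', hcount]
  rw [lintegral_finsetSum, Finset.sum_range]
  · refine Finset.sum_congr rfl fun k _ => ?_
    rw [← lintegral_indicator_one (hset k)]
    refine lintegral_congr fun p => ?_
    simp [Set.indicator_apply]
  · exact fun k _ => Measurable.ite (hset k) measurable_const measurable_const

/-! ### Binomial tails -/

/-- The binomial probability of `j` successes in `m` trials. -/
noncomputable def binomialMass (m : ℕ) (x : ℝ) (j : ℕ) : ℝ :=
  m.choose j * x ^ j * (1 - x) ^ (m - j)

lemma binomialMass_nonneg {m : ℕ} {x : ℝ} (h0 : 0 ≤ x) (h1 : x ≤ 1) (j : ℕ) :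
    0 ≤ binomialMass m x j := by
  have : 0 ≤ 1 - x := by linarith
  unfold binomialMass
  positivity

/-- The generating function: `z = 1` gives total mass `1`, and `z ≥ 1` gives Chernoff's bound. -/
lemma sum_pow_mul_binomialMass (m : ℕ) (x z : ℝ) :
    ∑ j ∈ Finset.range (m + 1), z ^ j * binomialMass m x j = (1 + x * (z - 1)) ^ m := by
  have h : 1 + x * (z - 1) = x * z + (1 - x) := by ring
  rw [h, add_pow]
  refine Finset.sum_congr rfl fun j _ => ?_
  rw [binomialMass, mul_pow]
  ring

/-- The binomial probability of more than `k` successes in `m` trials. -/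
noncomputable def binomialTail (m : ℕ) (x : ℝ) (k : ℕ) : ℝ :=
  ∑ j ∈ (Finset.range (m + 1)).filter (fun j => k < j), binomialMass m x j

lemma binomialTail_nonneg {m : ℕ} {x : ℝ} (h0 : 0 ≤ x) (h1 : x ≤ 1) (k : ℕ) :
    0 ≤ binomialTail m x k :=
  Finset.sum_nonneg fun j _ => binomialMass_nonneg h0 h1 j

lemma binomialTail_eq {m k : ℕ} (hk : k ≤ m) (x : ℝ) :
    binomialTail m x k = 1 - ∑ j ∈ Finset.range (k + 1), binomialMass m x j := by
  have h := sum_pow_mul_binomialMass m x 1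
  simp only [one_pow, one_mul, sub_self, mul_zero, add_zero] at h
  rw [← Finset.sum_filter_add_sum_filter_not _ (fun j => k < j)] at h
  have h2 : (Finset.range (m + 1)).filter (fun j => ¬ k < j) = Finset.range (k + 1) := by
    ext j
    simp only [Finset.mem_filter, Finset.mem_range]
    omega
  rw [h2] at h
  rw [binomialTail]
  linarith

/-- Chernoff's bound for the upper tail of the binomial distribution. -/
lemma binomialTail_le {m : ℕ} {x z : ℝ} (h0 : 0 ≤ x) (h1 : x ≤ 1) (hz : 1 ≤ z) (k : ℕ) :
    binomialTail m x k ≤ (z⁻¹) ^ (k + 1) * Real.exp (m * x * (z - 1)) := by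
  have hz0 : 0 < z := by linarith
  calc binomialTail m x k
      ≤ ∑ j ∈ (Finset.range (m + 1)).filter (fun j => k < j),
          (z⁻¹) ^ (k + 1) * (z ^ j * binomialMass m x j) := by
        refine Finset.sum_le_sum fun j hj => ?_
        have hj := (Finset.mem_filter.1 hj).2
        rw [← mul_assoc]
        refine le_mul_of_one_le_left (binomialMass_nonneg h0 h1 j) ?_
        rw [inv_pow, ← div_eq_inv_mul, le_div_iff₀ (by positivity), one_mul]
        exact pow_le_pow_right₀ hz hj
    _ ≤ ∑ j ∈ Finset.range (m + 1), (z⁻¹) ^ (k + 1) * (z ^ j * binomialMass m x j) := by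
        refine Finset.sum_le_sum_of_subset_of_nonneg (Finset.filter_subset _ _) fun j _ _ => ?_
        have := binomialMass_nonneg (m := m) h0 h1 j
        positivity
    _ = (z⁻¹) ^ (k + 1) * (1 + x * (z - 1)) ^ m := by
        rw [← Finset.mul_sum, sum_pow_mul_binomialMass]
    _ ≤ _ := by
        refine mul_le_mul_of_nonneg_left ?_ (by positivity)
        rw [mul_assoc, Real.exp_nat_mul]
        refine pow_le_pow_left₀ ?_ ?_ m
        · have := mul_nonneg h0 (sub_nonneg.2 hz)
          linarith
        · linarith [Real.add_one_le_exp (x * (z - 1))]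

open scoped Classical in
lemma unitCube_filter_eq {m : ℕ} {x : ℝ} (h0 : 0 ≤ x) (h1 : x ≤ 1) (S : Finset (Fin m)) :
    unitCube m {p | Finset.univ.filter (fun i => p i ≤ x) = S} =
      ENNReal.ofReal (x ^ S.card * (1 - x) ^ (m - S.card)) := by
  have hset : {p : Fin m → ℝ | Finset.univ.filter (fun i => p i ≤ x) = S} =
      Set.univ.pi fun i => if i ∈ S then Set.Iic x else Set.Ioi x := by
    ext p
    simp only [Set.mem_ofPred_eq, Finset.ext_iff, Finset.mem_filter, Finset.mem_univ, true_and,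
      Set.mem_univ_pi]
    refine forall_congr' fun i => ?_
    by_cases hi : i ∈ S <;> simp [hi]
  have hle : (volume : Measure ℝ).restrict (Set.Icc 0 1) (Set.Iic x) = ENNReal.ofReal x := by
    rw [Measure.restrict_apply measurableSet_Iic]
    have : Set.Iic x ∩ Set.Icc (0 : ℝ) 1 = Set.Icc 0 x := by
      ext t
      simp only [Set.mem_inter_iff, Set.mem_Iic, Set.mem_Icc]
      constructor
      · tauto
      · exact fun h => ⟨h.2, h.1, h.2.trans h1⟩
    rw [this, Real.volume_Icc, sub_zero]
  have hgt : (volume : Measure ℝ).restrict (Set.Icc 0 1) (Set.Ioi x) =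
      ENNReal.ofReal (1 - x) := by
    rw [Measure.restrict_apply measurableSet_Ioi]
    have : Set.Ioi x ∩ Set.Icc (0 : ℝ) 1 = Set.Ioc x 1 := by
      ext t
      simp only [Set.mem_inter_iff, Set.mem_Ioi, Set.mem_Icc, Set.mem_Ioc]
      constructor
      · tauto
      · exact fun h => ⟨h.1, h0.trans h.1.le, h.2⟩
    rw [this, Real.volume_Ioc]
  rw [hset, unitCube, Measure.pi_pi]
  have h : ∀ i, (volume : Measure ℝ).restrict (Set.Icc 0 1)
      (if i ∈ S then Set.Iic x else Set.Ioi x) =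
      if i ∈ S then ENNReal.ofReal x else ENNReal.ofReal (1 - x) := by
    intro i
    split_ifs
    exacts [hle, hgt]
  simp_rw [h]
  have hx' : 0 ≤ 1 - x := by linarith
  rw [Finset.prod_ite, Finset.prod_const, Finset.prod_const, ENNReal.ofReal_mul (by positivity),
    ENNReal.ofReal_pow h0, ENNReal.ofReal_pow hx']
  congr 3
  · simp
  · rw [Finset.filter_not, Finset.card_sdiff_of_subset (Finset.filter_subset _ _)]
    simp

open scoped Classical in
/-- The number of coordinates below `x` of a uniform sample has a binomial distribution. -/
lemma unitCube_lt_card_filter {m : ℕ} {x : ℝ} (h0 : 0 ≤ x) (h1 : x ≤ 1) (k : ℕ) :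
    unitCube m {p | k < (Finset.univ.filter fun i => p i ≤ x).card} =
      ENNReal.ofReal (binomialTail m x k) := by
  have hmeas : ∀ S : Finset (Fin m),
      MeasurableSet {p : Fin m → ℝ | Finset.univ.filter (fun i => p i ≤ x) = S} := by
    intro S
    simp only [Finset.ext_iff, Finset.mem_filter, Finset.mem_univ, true_and, Set.ofPred_forall]
    refine MeasurableSet.iInter fun i => ?_
    by_cases hi : i ∈ S
    · simpa [hi] using measurableSet_le (measurable_pi_apply i) measurable_const
    · simpa [hi] using measurableSet_lt measurable_const (measurable_pi_apply i)
  have hset : {p : Fin m → ℝ | k < (Finset.univ.filter fun i => p i ≤ x).card} =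
      ⋃ S ∈ (Finset.univ : Finset (Finset (Fin m))).filter (fun S => k < S.card),
        {p : Fin m → ℝ | Finset.univ.filter (fun i => p i ≤ x) = S} := by
    ext p
    simp
  rw [hset, measure_biUnion_finset]
  · simp_rw [unitCube_filter_eq h0 h1]
    have hnn : ∀ j : ℕ, 0 ≤ x ^ j * (1 - x) ^ (m - j) := fun j => by
      have : 0 ≤ 1 - x := by linarith
      positivity
    rw [← ENNReal.ofReal_sum_of_nonneg fun S _ => hnn _]
    congr 1
    rw [Finset.sum_filter, ← Finset.powerset_univ, binomialTail, Finset.sum_filter,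
      Finset.sum_powerset_apply_card
        (fun j => if k < j then x ^ j * (1 - x) ^ (m - j) else (0 : ℝ))]
    simp only [Finset.card_univ, Fintype.card_fin, nsmul_eq_mul]
    refine Finset.sum_congr rfl fun j _ => ?_
    split_ifs
    · rw [binomialMass, mul_assoc]
    · simp
  · intro S _ T _ hST
    refine Set.disjoint_left.2 fun p hS hT => hST ?_
    exact hS.symm.trans hT
  · exact fun S _ => hmeas S

/-! ### Poisson limits, Gamma probabilities and their sum -/

/-- The Poisson probability of more than `k` points. -/
noncomputable def poissonTail (r : ℝ) (k : ℕ) : ℝ :=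
  1 - ∑ j ∈ Finset.range (k + 1), Real.exp (-r) * r ^ j / j.factorial

/-- The law of rare events is applied to the complement, whose number of terms does not grow with
`m`. -/
lemma tendsto_binomialTail (r : ℝ) (k : ℕ) :
    Tendsto (fun m : ℕ => binomialTail m (r / m) k) atTop (𝓝 (poissonTail r k)) := by
  have h1 : Tendsto (fun m : ℕ => 1 - ∑ j ∈ Finset.range (k + 1), binomialMass m (r / m) j) atTop
      (𝓝 (poissonTail r k)) := by
    refine tendsto_const_nhds.sub (tendsto_finsetSum _ fun j _ => ?_)
    refine tendsto_choose_mul_pow_of_tendsto_mul_atTop j ?_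
    refine tendsto_const_nhds.congr' ?_
    filter_upwards [eventually_ge_atTop 1] with m hm
    field_simp
  refine h1.congr' ?_
  filter_upwards [eventually_ge_atTop k] with m hm
  rw [binomialTail_eq hm]

/-- The derivatives of the Poisson terms telescope, and the survivor is the Gamma density of shape
`k + 1` and rate `r`. -/
lemma hasDerivAt_poissonTail (r x : ℝ) (k : ℕ) :
    HasDerivAt (fun x => poissonTail (r * x) k)
      (r * (Real.exp (-(r * x)) * (r * x) ^ k / k.factorial)) x := by
  have hmul : HasDerivAt (fun x : ℝ => r * x) r x := by
    simpa using (hasDerivAt_id x).const_mul r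
  have hexp : HasDerivAt (fun x : ℝ => Real.exp (-(r * x))) (Real.exp (-(r * x)) * -r) x :=
    hmul.neg.exp
  induction k with
  | zero =>
    have : (fun x => poissonTail (r * x) 0) = fun x => 1 - Real.exp (-(r * x)) := by
      funext x
      simp [poissonTail]
    rw [this]
    refine (hexp.const_sub 1).congr_deriv ?_
    simp
    ring
  | succ k ih =>
    have : (fun x => poissonTail (r * x) (k + 1)) = fun x => poissonTail (r * x) k -
        Real.exp (-(r * x)) * (r * x) ^ (k + 1) / (k + 1).factorial := by
      funext x
      rw [poissonTail, Finset.sum_range_succ, poissonTail]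
      ring
    rw [this]
    refine (ih.sub ((hexp.mul (hmul.pow (k + 1))).div_const
      ((k + 1).factorial : ℝ))).congr_deriv ?_
    have hk : (k.factorial : ℝ) ≠ 0 := by positivity
    have hk1 : (k : ℝ) + 1 ≠ 0 := by positivity
    rw [Nat.factorial_succ]
    simp only [Nat.add_sub_cancel, Pi.pow_apply]
    push_cast
    field_simp
    ring

/-- The distribution function of the Gamma distribution with an integral shape. -/
lemma gammaMeasure_Iic (k : ℕ) {r q : ℝ} (hr : 0 < r) (hq : 0 ≤ q) :
    gammaMeasure ((k : ℝ) + 1) r (Set.Iic q) = ENNReal.ofReal (poissonTail (r * q) k) := by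
  have hk : (0 : ℝ) < (k : ℝ) + 1 := by positivity
  have hpdf : ∀ x ∈ Set.Icc 0 q, gammaPDF ((k : ℝ) + 1) r x =
      ENNReal.ofReal (r * (Real.exp (-(r * x)) * (r * x) ^ k / k.factorial)) := by
    intro x hx
    rw [gammaPDF_of_nonneg hx.1, Real.Gamma_nat_eq_factorial, add_sub_cancel_right,
      Real.rpow_natCast, mul_pow]
    have : r ^ ((k : ℝ) + 1) = r ^ (k + 1) := by exact_mod_cast Real.rpow_natCast r (k + 1)
    rw [this]
    congr 1
    ring
  rw [gammaMeasure, withDensity_apply _ measurableSet_Iic,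
    lintegral_Iic_eq_lintegral_Iio_add_Icc _ hq, lintegral_gammaPDF_of_nonpos le_rfl, zero_add,
    setLIntegral_congr_fun measurableSet_Icc hpdf]
  have hcont : Continuous fun x : ℝ => r * (Real.exp (-(r * x)) * (r * x) ^ k / k.factorial) := by
    fun_prop
  have hftc := intervalIntegral.integral_eq_sub_of_hasDerivAt
    (fun x _ => hasDerivAt_poissonTail r x k) (hcont.intervalIntegrable 0 q)
  have h0 : poissonTail (r * 0) k = 0 := by
    rw [poissonTail, Finset.sum_range_succ']
    simp
  rw [h0, sub_zero, intervalIntegral.integral_of_le hq, ← integral_Icc_eq_integral_Ioc] at hftc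
  rw [← hftc, ofReal_integral_eq_lintegral_ofReal hcont.integrableOn_Icc]
  filter_upwards [ae_restrict_mem measurableSet_Icc] with x hx
  have := mul_nonneg hr.le hx.1
  simp only [Pi.zero_apply]
  positivity

lemma exists_binomialTail_le {q : ℝ} (hq : 0 ≤ q) (hq1 : q < 1) :
    ∃ ρ : ℝ, 0 ≤ ρ ∧ ρ < 1 ∧
      ∀ m k : ℕ, k < m → binomialTail m (q * ((k : ℝ) + 1) / m) k ≤ ρ ^ (k + 1) := by
  -- The best Chernoff parameter is `z = 1 / q`. Using `s ≥ q` instead covers `q = 0`, and `q (1 / s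
  -- - 1) ≤ 1 - s` yields the ratio `s * exp (1 - s) < 1`.
  set s : ℝ := max q (1 / 2)
  have hs0 : 0 < s := lt_of_lt_of_le (by norm_num) (le_max_right _ _)
  have hs1 : s < 1 := max_lt hq1 (by norm_num)
  have hqs : q ≤ s := le_max_left _ _
  refine ⟨s * Real.exp (1 - s), by positivity, ?_, fun m k hk => ?_⟩
  · have h := Real.add_one_lt_exp (x := s - 1) (by linarith)
    have he : Real.exp (1 - s) = (Real.exp (s - 1))⁻¹ := by rw [← Real.exp_neg]; ring_nf
    rw [he, ← div_eq_mul_inv, div_lt_one (Real.exp_pos _)]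
    linarith
  · have hm : (0 : ℝ) < m := by exact_mod_cast (Nat.zero_le k).trans_lt hk
    have hkm : (k : ℝ) + 1 ≤ m := by exact_mod_cast hk
    have hk0 : (0 : ℝ) ≤ (k : ℝ) + 1 := by positivity
    refine (binomialTail_le (z := s⁻¹) (by positivity) ?_ ((one_le_inv₀ hs0).2 hs1.le) k).trans ?_
    · rw [div_le_one hm]
      nlinarith
    · rw [inv_inv, mul_pow, ← Real.exp_nat_mul]
      refine mul_le_mul_of_nonneg_left (Real.exp_le_exp.2 ?_) (by positivity)
      have h1 : (m : ℝ) * (q * ((k : ℝ) + 1) / m) * (s⁻¹ - 1) =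
          ((k : ℝ) + 1) * (q * (s⁻¹ - 1)) := by
        field_simp
      rw [h1]
      push_cast
      refine mul_le_mul_of_nonneg_left ?_ hk0
      have h2 : 1 - s = s * (s⁻¹ - 1) := by field_simp
      rw [h2]
      exact mul_le_mul_of_nonneg_right hqs (sub_nonneg.2 ((one_le_inv₀ hs0).2 hs1.le))

lemma binomialTail_of_le {m k : ℕ} (h : m ≤ k) (x : ℝ) : binomialTail m x k = 0 := by
  rw [binomialTail, Finset.filter_false_of_mem, Finset.sum_empty]
  intro j hj
  have := Finset.mem_range.1 hj
  omega

lemma gammaSum_eq {q : ℝ} (hq : 0 ≤ q) :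
    gammaSum q = ∑' k : ℕ, ENNReal.ofReal (poissonTail (q * ((k : ℝ) + 1)) k) := by
  refine tsum_congr fun k => ?_
  rw [gammaMeasure_Iic k (by positivity) hq, mul_comm]

/-- A crude Stirling bound, `N! ≤ e N (N / e) ^ N` with `N = n + 1`; the induction step is `(1 - 1 /
(n + 2)) ^ (n + 2) ≤ 1 / e`. -/
lemma factorial_mul_exp_le (n : ℕ) :
    ((n + 1).factorial : ℝ) * Real.exp (n + 1) ≤ Real.exp 1 * ((n : ℝ) + 1) ^ (n + 2) := by
  induction n with
  | zero => simp
  | succ n ih =>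
    have hn : (0 : ℝ) < (n : ℝ) + 1 := by positivity
    have hn2 : (0 : ℝ) < (n : ℝ) + 2 := by positivity
    have hexp : Real.exp 1 * ((n : ℝ) + 1) ^ (n + 2) ≤ ((n : ℝ) + 2) ^ (n + 2) := by
      have h := Real.add_one_le_exp (-(1 / ((n : ℝ) + 2)))
      have h1 : ((n : ℝ) + 1) / (n + 2) ≤ Real.exp (-(1 / ((n : ℝ) + 2))) := by
        refine le_trans (le_of_eq ?_) h
        field_simp
        ring
      have h2 : (((n : ℝ) + 1) / (n + 2)) ^ (n + 2) ≤ Real.exp (-1) := by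
        refine (pow_le_pow_left₀ (by positivity) h1 _).trans (le_of_eq ?_)
        rw [← Real.exp_nat_mul]
        congr 1
        push_cast
        field_simp
      rw [div_pow, div_le_iff₀ (by positivity), Real.exp_neg, ← div_eq_inv_mul,
        le_div_iff₀ (Real.exp_pos _)] at h2
      linarith
    calc ((n + 1 + 1).factorial : ℝ) * Real.exp (((n + 1 : ℕ) : ℝ) + 1)
        = ((n : ℝ) + 2) * Real.exp 1 * (((n + 1).factorial : ℝ) * Real.exp (n + 1)) := by
          rw [Nat.factorial_succ (n + 1)]
          push_cast
          rw [Real.exp_add _ 1]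
          ring
      _ ≤ ((n : ℝ) + 2) * Real.exp 1 * (Real.exp 1 * ((n : ℝ) + 1) ^ (n + 2)) :=
          mul_le_mul_of_nonneg_left ih (by positivity)
      _ ≤ ((n : ℝ) + 2) * Real.exp 1 * ((n : ℝ) + 2) ^ (n + 2) :=
          mul_le_mul_of_nonneg_left hexp (by positivity)
      _ = _ := by
          push_cast
          ring

/-- The single Poisson mass at `k + 1`, the mean itself, already gives this bound, which suffices
for divergence. -/
lemma le_poissonTail (k : ℕ) :
    (Real.exp 1)⁻¹ * (1 / ((k : ℝ) + 1)) ≤ poissonTail ((k : ℝ) + 1) k := by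
  set r : ℝ := (k : ℝ) + 1 with hr
  have hr0 : 0 < r := by positivity
  have h1 : ∑ j ∈ Finset.range (k + 2), Real.exp (-r) * r ^ j / j.factorial ≤ 1 := by
    have h := Real.sum_le_exp_of_nonneg hr0.le (k + 2)
    calc ∑ j ∈ Finset.range (k + 2), Real.exp (-r) * r ^ j / j.factorial
        = Real.exp (-r) * ∑ j ∈ Finset.range (k + 2), r ^ j / j.factorial := by
          rw [Finset.mul_sum]
          exact Finset.sum_congr rfl fun j _ => by ring
      _ ≤ Real.exp (-r) * Real.exp r := mul_le_mul_of_nonneg_left h (Real.exp_pos _).le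
      _ = 1 := by rw [← Real.exp_add]; simp
  rw [Finset.sum_range_succ] at h1
  have h2 : (Real.exp 1)⁻¹ * (1 / r) ≤ Real.exp (-r) * r ^ (k + 1) / (k + 1).factorial := by
    have hf : (0 : ℝ) < (k + 1).factorial := by positivity
    have he := Real.exp_pos 1
    have her := Real.exp_pos r
    have h := factorial_mul_exp_le k
    rw [Real.exp_neg, le_div_iff₀ hf, mul_one_div, div_mul_eq_mul_div, div_le_iff₀ hr0,
      inv_mul_le_iff₀ he]
    rw [← hr] at h
    have h3 : Real.exp 1 * ((Real.exp r)⁻¹ * r ^ (k + 1) * r) =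
        (Real.exp 1 * r ^ (k + 2)) / Real.exp r := by
      rw [div_eq_mul_inv]
      ring
    rw [h3, le_div_iff₀ her]
    exact h
  rw [poissonTail]
  linarith

/-- Monotonicity in `q` reduces to `q = 1`, where the harmonic series is a lower bound. -/
lemma gammaSum_eq_top {q : ℝ} (hq : 1 ≤ q) : gammaSum q = ∞ := by
  have h1 : ∑' k : ℕ, ENNReal.ofReal ((Real.exp 1)⁻¹ * (1 / ((k : ℝ) + 1))) ≤ gammaSum q := by
    refine ENNReal.tsum_le_tsum fun k => ?_
    have hk : (0 : ℝ) < (k : ℝ) + 1 := by positivity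
    calc ENNReal.ofReal ((Real.exp 1)⁻¹ * (1 / ((k : ℝ) + 1)))
        ≤ ENNReal.ofReal (poissonTail (((k : ℝ) + 1) * 1) k) := by
          rw [mul_one]
          exact ENNReal.ofReal_le_ofReal (le_poissonTail k)
      _ = gammaMeasure ((k : ℝ) + 1) ((k : ℝ) + 1) (Set.Iic 1) :=
          (gammaMeasure_Iic k hk zero_le_one).symm
      _ ≤ _ := measure_mono (Set.Iic_subset_Iic.2 hq)
  have h2 : ∑' k : ℕ, ENNReal.ofReal ((Real.exp 1)⁻¹ * (1 / ((k : ℝ) + 1))) = ∞ := by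
    by_contra h
    have hs := ENNReal.summable_toReal h
    have hs' : Summable fun k : ℕ => (Real.exp 1)⁻¹ * (1 / ((k : ℝ) + 1)) := by
      refine hs.congr fun k => ?_
      exact ENNReal.toReal_ofReal (by positivity)
    rw [summable_mul_left_iff (inv_ne_zero (Real.exp_pos 1).ne')] at hs'
    refine Real.not_summable_one_div_natCast ((summable_nat_add_iff 1).1 ?_)
    exact_mod_cast hs'
  exact top_le_iff.1 (h2 ▸ h1)

/-! ### Convergence of the mean number of rejections -/

open scoped Classical in
/-- The mean number of rejections under the uniform distribution converges, and the limit is finite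
below the critical level. -/
theorem tendsto_lintegral_lastMinimizer {q : ℝ} (hq : 0 ≤ q) :
    Tendsto (fun m : ℕ => ∫⁻ p, ((lastMinimizer q p : ℕ) : ℝ≥0∞) ∂unitCube m) atTop
      (𝓝 (gammaSum q)) ∧ (q < 1 → gammaSum q < ∞) := by
  have hle : ∀ m k : ℕ, k < m → q ≤ 1 → q * ((k : ℝ) + 1) / m ≤ 1 := by
    intro m k hk h1
    have hm : (0 : ℝ) < m := by exact_mod_cast (Nat.zero_le k).trans_lt hk
    have hkm : (k : ℝ) + 1 ≤ m := by exact_mod_cast hk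
    rw [div_le_one hm]
    nlinarith
  have hterm : ∀ k : ℕ, Tendsto (fun m : ℕ => binomialTail m (q * ((k : ℝ) + 1) / m) k) atTop
      (𝓝 (poissonTail (q * ((k : ℝ) + 1)) k)) := fun k => tendsto_binomialTail _ k
  rcases lt_or_ge q 1 with h1 | h1
  · obtain ⟨ρ, hρ0, hρ1, hρ⟩ := exists_binomialTail_le hq h1
    have hnn : ∀ m k : ℕ, 0 ≤ binomialTail m (q * ((k : ℝ) + 1) / m) k := by
      intro m k
      rcases lt_or_ge k m with hk | hk
      · exact binomialTail_nonneg (by positivity) (hle m k hk h1.le) k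
      · exact (binomialTail_of_le hk _).ge
    have hbd : ∀ m k : ℕ, binomialTail m (q * ((k : ℝ) + 1) / m) k ≤ ρ ^ (k + 1) := by
      intro m k
      rcases lt_or_ge k m with hk | hk
      · exact hρ m k hk
      · rw [binomialTail_of_le hk]
        positivity
    have hsum : Summable fun k : ℕ => ρ ^ (k + 1) :=
      (summable_nat_add_iff 1).2 (summable_geometric_of_lt_one hρ0 hρ1)
    have hP0 : ∀ k : ℕ, 0 ≤ poissonTail (q * ((k : ℝ) + 1)) k := fun k =>
      ge_of_tendsto' (hterm k) fun m => hnn m k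
    have hPbd : ∀ k : ℕ, poissonTail (q * ((k : ℝ) + 1)) k ≤ ρ ^ (k + 1) := fun k =>
      le_of_tendsto' (hterm k) fun m => hbd m k
    have hPsum := Summable.of_nonneg_of_le hP0 hPbd hsum
    have hlim := tendsto_tsum_of_dominated_convergence (𝓕 := atTop) hsum hterm
      (Eventually.of_forall fun m k => by
        rw [Real.norm_of_nonneg (hnn m k)]
        exact hbd m k)
    have hM : ∀ m : ℕ, ∫⁻ p, ((lastMinimizer q p : ℕ) : ℝ≥0∞) ∂unitCube m =
        ENNReal.ofReal (∑' k : ℕ, binomialTail m (q * ((k : ℝ) + 1) / m) k) := by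
      intro m
      rw [lintegral_lastMinimizer, tsum_eq_sum (s := Finset.range m),
        ENNReal.ofReal_sum_of_nonneg fun k _ => hnn m k]
      · refine Finset.sum_congr rfl fun k hk => ?_
        exact unitCube_lt_card_filter (by positivity) (hle m k (Finset.mem_range.1 hk) h1.le) k
      · intro k hk
        exact binomialTail_of_le (by simpa using hk) _
    have hG : gammaSum q = ENNReal.ofReal (∑' k : ℕ, poissonTail (q * ((k : ℝ) + 1)) k) := by
      rw [gammaSum_eq hq, ENNReal.ofReal_tsum_of_nonneg hP0 hPsum]
    simp_rw [hM, hG]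
    exact ⟨ENNReal.tendsto_ofReal hlim, fun _ => ENNReal.ofReal_lt_top⟩
  · refine ⟨?_, fun h => absurd h (not_lt.2 h1)⟩
    rw [gammaSum_eq_top h1, ENNReal.tendsto_nhds_top_iff_nnreal]
    intro c
    have hpart : Tendsto (fun K : ℕ => ∑ k ∈ Finset.range K,
        ENNReal.ofReal (poissonTail (q * ((k : ℝ) + 1)) k)) atTop (𝓝 ∞) := by
      rw [← gammaSum_eq_top h1, gammaSum_eq hq]
      exact ENNReal.tendsto_nat_tsum _
    obtain ⟨K, hK⟩ := (hpart.eventually (lt_mem_nhds (ENNReal.coe_lt_top (r := c)))).exists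
    have hfin : Tendsto (fun m : ℕ => ∑ k ∈ Finset.range K,
        ENNReal.ofReal (binomialTail m (q * ((k : ℝ) + 1) / m) k)) atTop
        (𝓝 (∑ k ∈ Finset.range K, ENNReal.ofReal (poissonTail (q * ((k : ℝ) + 1)) k))) :=
      tendsto_finsetSum _ fun k _ => ENNReal.tendsto_ofReal (hterm k)
    -- The condition `q * K ≤ m` keeps the thresholds `q (k + 1) / m` with `k < K` at most `1`, so
    -- that the binomial formula applies to the truncated sum.
    filter_upwards [hfin.eventually (lt_mem_nhds hK), eventually_ge_atTop K,
      eventually_ge_atTop 1, tendsto_natCast_atTop_atTop.eventually (eventually_ge_atTop (q * K))]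
      with m hm hKm hm1 hqm
    refine hm.trans_le ?_
    rw [lintegral_lastMinimizer]
    refine le_trans (Finset.sum_le_sum fun k hk => ?_)
      (Finset.sum_le_sum_of_subset (Finset.range_subset_range.2 hKm))
    have hm0 : (0 : ℝ) < m := by exact_mod_cast hm1
    have hkK : (k : ℝ) + 1 ≤ K := by exact_mod_cast Finset.mem_range.1 hk
    refine (unitCube_lt_card_filter (by positivity) ?_ k).ge
    rw [div_le_one hm0]
    exact (mul_le_mul_of_nonneg_left hkK hq).trans hqm

/-! ### From rejections to regret -/

/-- Without ties exactly `R_q` values reach the threshold; positivity handles `R_q = 0`, where the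
threshold is `0`. -/
lemma card_slProcedure {m : ℕ} (q : ℝ) {p : Fin m → ℝ} (hp : Function.Injective p)
    (hpos : ∀ i, 0 < p i) : (slProcedure q p).card = (lastMinimizer q p : ℕ) := by
  classical
  have hmono : StrictMono (p ∘ Tuple.sort p) :=
    (Tuple.monotone_sort p).strictMono_of_injective (hp.comp (Equiv.injective _))
  rw [slProcedure]
  generalize lastMinimizer q p = R
  cases R using Fin.cases with
  | zero =>
    rw [Finset.filter_false_of_mem]
    · simp
    · intro i _
      simpa [orderStat] using hpos i
  | succ j =>
    have h : (Finset.Iic j).card = (Finset.univ.filter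
        fun i => p i ≤ orderStat p j.succ).card := by
      refine Finset.card_equiv (Tuple.sort p) fun i => ?_
      rw [Finset.mem_Iic, Finset.mem_filter_univ]
      exact hmono.le_iff_le.symm
    rw [Fin.card_Iic] at h
    rw [Fin.val_succ, h]

lemma excessLoss_of_null {m : ℕ} {lam : ℝ} (hlam : 0 < lam) (f1 : ℝ → ℝ) (q : ℝ)
    {H : Fin m → Fin 2} (hH : ∀ i, H i = 0) {p : Fin m → ℝ} (hp : Function.Injective p)
    (hpos : ∀ i, 0 < p i) :
    excessLoss lam 1 f1 (slProcedure q) H p = lam * (lastMinimizer q p : ℕ) / m := by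
  have ho : oracleProcedure lam 1 f1 p = ∅ := by
    classical
    rw [oracleProcedure, Finset.filter_false_of_mem]
    intro i _
    have : 1 / (1 + lam) < 1 := by rw [div_lt_one (by linarith)]; linarith
    simpa [lfdr] using this
  rw [excessLoss, ho]
  simp only [loss, hH, Finset.filter_true, card_slProcedure q hp hpos, Finset.filter_empty,
    Finset.card_empty]
  push_cast
  ring

variable {Ω : Type*} [MeasurableSpace Ω] {μ : Measure Ω} {f1 : ℝ → ℝ} {m : ℕ}
  {H : Fin m → Ω → Fin 2} {p : Fin m → Ω → ℝ}

lemma IsTwoGroups.law_of_null (h : IsTwoGroups μ 1 f1 H p) (i : Fin m) :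
    μ.map (fun ω => (H i ω, p i ω)) =
      (Measure.dirac (0 : Fin 2)).prod ((volume : Measure ℝ).restrict (Set.Icc 0 1)) := by
  rw [h.law i, twoGroupsLaw]
  simp

lemma IsTwoGroups.ae_null (h : IsTwoGroups μ 1 f1 H p) : ∀ᵐ ω ∂μ, ∀ i, H i ω = 0 := by
  rw [ae_all_iff]
  intro i
  have hm : Measurable (fun ω => (H i ω, p i ω)) := (h.measurable_H i).prodMk (h.measurable_p i)
  have h1 : μ {ω | H i ω ≠ 0} = 0 := by
    have hs : MeasurableSet ({0}ᶜ ×ˢ Set.univ : Set (Fin 2 × ℝ)) :=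
      (MeasurableSet.singleton _).compl.prod MeasurableSet.univ
    have h2 := Measure.map_apply (μ := μ) hm hs
    rw [h.law_of_null i, Measure.prod_prod] at h2
    have h3 : (fun ω => (H i ω, p i ω)) ⁻¹' ({0}ᶜ ×ˢ Set.univ) = {ω | H i ω ≠ 0} := by
      ext ω
      simp
    rw [h3] at h2
    rw [← h2]
    simp
  exact ae_iff.2 h1

lemma IsTwoGroups.map_eq_unitCube [IsProbabilityMeasure μ] (h : IsTwoGroups μ 1 f1 H p) :
    μ.map (fun ω i => p i ω) = unitCube m := by
  have hind : iIndepFun p μ := h.indep.comp (fun _ => Prod.snd) fun _ => measurable_snd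
  rw [(iIndepFun_iff_map_fun_eq_pi_map fun i => (h.measurable_p i).aemeasurable).1 hind, unitCube]
  congr 1
  funext i
  have hm : Measurable (fun ω => (H i ω, p i ω)) := (h.measurable_H i).prodMk (h.measurable_p i)
  have h2 := Measure.map_map (μ := μ) measurable_snd hm
  rw [h.law_of_null i, Measure.map_snd_prod] at h2
  rw [measure_univ, one_smul] at h2
  exact h2.symm

lemma IsTwoGroups.excessLoss_ae_eq [IsProbabilityMeasure μ] (h : IsTwoGroups μ 1 f1 H p)
    {lam : ℝ} (hlam : 0 < lam) (q : ℝ) :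
    (fun ω => excessLoss lam 1 f1 (slProcedure q) (fun i => H i ω) (fun i => p i ω)) =ᵐ[μ]
      fun ω => lam * (lastMinimizer q (fun i => p i ω) : ℕ) / m := by
  have hm : AEMeasurable (fun ω i => p i ω) μ :=
    (measurable_pi_lambda _ h.measurable_p).aemeasurable
  have h1 : ∀ᵐ ω ∂μ, Function.Injective fun i => p i ω :=
    ae_of_ae_map hm (h.map_eq_unitCube ▸ ae_injective m)
  have h2 : ∀ᵐ ω ∂μ, ∀ i, p i ω ∈ Set.Ioc (0 : ℝ) 1 :=
    ae_of_ae_map hm (p := fun y : Fin m → ℝ => ∀ i, y i ∈ Set.Ioc (0 : ℝ) 1)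
      (h.map_eq_unitCube ▸ ae_mem_Ioc m)
  filter_upwards [h.ae_null, h1, h2] with ω hH hinj hmem
  exact excessLoss_of_null hlam f1 q hH hinj fun i => (hmem i).1

lemma measurable_natCast_lastMinimizer (m : ℕ) (q : ℝ) :
    Measurable (fun y : Fin m → ℝ => ((lastMinimizer q y : ℕ) : ℝ)) :=
  (Measurable.of_discrete (f := fun k : Fin (m + 1) => ((k : ℕ) : ℝ))).comp
    (measurable_lastMinimizer q)

/-- This makes `regret` a genuine expectation, not the default value `0` of the Bochner integral. -/
lemma IsTwoGroups.integrable_excessLoss [IsProbabilityMeasure μ] (h : IsTwoGroups μ 1 f1 H p)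
    {lam : ℝ} (hlam : 0 < lam) (q : ℝ) :
    Integrable (fun ω => excessLoss lam 1 f1 (slProcedure q) (fun i => H i ω)
      (fun i => p i ω)) μ := by
  rw [integrable_congr (h.excessLoss_ae_eq hlam q)]
  have hmeas := (measurable_natCast_lastMinimizer m q).comp
    (measurable_pi_lambda _ h.measurable_p)
  refine ((Integrable.of_bound hmeas.aestronglyMeasurable (m : ℝ) ?_).const_mul lam).div_const _
  refine Eventually.of_forall fun ω => ?_
  simp only [Function.comp_apply, Real.norm_natCast]
  exact_mod_cast Nat.lt_succ_iff.1 (Fin.is_lt _)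

lemma lintegral_lastMinimizer_ne_top (m : ℕ) (q : ℝ) :
    ∫⁻ y, ((lastMinimizer q y : ℕ) : ℝ≥0∞) ∂unitCube m ≠ ∞ := by
  refine ne_top_of_le_ne_top (ENNReal.natCast_ne_top m) ?_
  calc ∫⁻ y, ((lastMinimizer q y : ℕ) : ℝ≥0∞) ∂unitCube m
      ≤ ∫⁻ _, (m : ℝ≥0∞) ∂unitCube m := lintegral_mono fun y => by
        exact Nat.cast_le.2 (Nat.lt_succ_iff.1 (Fin.is_lt (lastMinimizer q y)))
    _ = m := by simp

lemma IsTwoGroups.mul_regret [IsProbabilityMeasure μ] (h : IsTwoGroups μ 1 f1 H p)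
    {lam : ℝ} (hlam : 0 < lam) (q : ℝ) (hm : m ≠ 0) :
    (m : ℝ) * regret μ lam 1 f1 H p (slProcedure q) =
      lam * (∫⁻ y, ((lastMinimizer q y : ℕ) : ℝ≥0∞) ∂unitCube m).toReal := by
  have hm' : (m : ℝ) ≠ 0 := by exact_mod_cast hm
  have h1 : ∫ ω, ((lastMinimizer q (fun i => p i ω) : ℕ) : ℝ) ∂μ =
      ∫ y, ((lastMinimizer q y : ℕ) : ℝ) ∂unitCube m := by
    rw [← h.map_eq_unitCube, integral_map (measurable_pi_lambda _ h.measurable_p).aemeasurable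
      (measurable_natCast_lastMinimizer m q).aestronglyMeasurable]
  rw [regret, integral_congr_ae (h.excessLoss_ae_eq hlam q), integral_div, integral_const_mul, h1,
    integral_eq_lintegral_of_nonneg_ae (Eventually.of_forall fun y => Nat.cast_nonneg _)
      (measurable_natCast_lastMinimizer m q).aestronglyMeasurable]
  simp only [ENNReal.ofReal_natCast]
  field_simp

end SupportLine

theorem proposition1
    {Ω : ℕ → Type*} [∀ m, MeasurableSpace (Ω m)]
    (μ : ∀ m, Measure (Ω m)) [∀ m, IsProbabilityMeasure (μ m)]
    (H : ∀ m, Fin m → Ω m → Fin 2) (p : ∀ m, Fin m → Ω m → ℝ)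
    (f1 : ℝ → ℝ)
    (hmodel : ∀ m, SupportLine.IsTwoGroups (μ m) 1 f1 (H m) (p m))
    (lam : ℝ) (hlam : 0 < lam) (q : ℝ) (hq : 0 ≤ q) :
    (∀ m, Integrable (fun ω => SupportLine.excessLoss lam 1 f1 (SupportLine.slProcedure q)
        (fun i => H m i ω) (fun i => p m i ω)) (μ m)) ∧
    Tendsto
      (fun m : ℕ => (((m : ℝ) *
        SupportLine.regret (μ m) lam 1 f1 (H m) (p m) (SupportLine.slProcedure q) : ℝ) : EReal))
      atTop (𝓝 ((ENNReal.ofReal lam * SupportLine.gammaSum q : ℝ≥0∞) : EReal)) ∧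
    (q < 1 → ENNReal.ofReal lam * SupportLine.gammaSum q < ∞) := by
  obtain ⟨hlim, hfin⟩ := SupportLine.tendsto_lintegral_lastMinimizer hq
  refine ⟨fun m => (hmodel m).integrable_excessLoss hlam q, ?_, fun h =>
    ENNReal.mul_lt_top ENNReal.ofReal_lt_top (hfin h)⟩
  have h1 := ENNReal.Tendsto.const_mul (a := ENNReal.ofReal lam) hlim
    (Or.inr ENNReal.ofReal_ne_top)
  have h2 := (continuous_coe_ennreal_ereal.tendsto _).comp h1
  refine h2.congr' ?_
  filter_upwards [eventually_ge_atTop 1] with m hm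
  rw [(hmodel m).mul_regret hlam q (by omega)]
  have hne := SupportLine.lintegral_lastMinimizer_ne_top m q
  rw [Function.comp_apply, ← EReal.coe_ennreal_toReal (ENNReal.mul_ne_top ENNReal.ofReal_ne_top hne),
    ENNReal.toReal_mul, ENNReal.toReal_ofReal hlam.le]
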